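/- A \emph{tree plan} is a pair $\Gamma=(\Gamma,\lambda)$, where $\Gamma\subset\omega^{<\omega}$ is a finite set of finite sequences that contains the empty sequence $\langle\rangle$ and is closed under initial segments, and $\lambda:\Gamma\to\{1,\infty\}$ satisfies $\lambda(\langle\rangle)=1$. For a non-empty set $X$, let $\Gamma(X)$ be the set of all finite sequences $\langle (i_0,t_0),\dots,(i_n,t_n)\rangle$ (including the empty one) over $\omega\times(X\cup\{\star\})$, where $\star\notin X$, such that $\langle i_0,\dots,i_n\rangle\in\Gamma$ and, for each $k\le n$, $t_k=\star$ if $\lambda(\langle i_0,\dots,i_k\rangle)=1$ and $t_k\in X$ if $\lambda(\langle i_0,\dots,i_k\rangle)=\infty$. Let $\pi_X:\Gamma(X)\to\Gamma$ send $\langle (i_0,t_0),\dots,(i_n,t_n)\rangle$ to $\langle i_0,\dots,i_n\rangle$. Let $\mathcal L_\Gamma$ be the language with a binary relation symbol $\le$, a constant symbol $\varepsilon$, a unary function symbol $\mathtt{pred}$, a binary function symbol $\sqcap$, and a unary relation symbol $P_\sigma$ for each $\sigma\in\Gamma$. View $\Gamma(X)$ as an $\mathcal L_\Gamma$-structure in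 which $\le$ is the initial-segment order, $\varepsilon$ is the empty sequence, $\mathtt{pred}$ deletes the last entry (with $\mathtt{pred}(\varepsilon)=\varepsilon$), $a\sqcap b$ is the longest common initial segment of $a$ and $b$, and $P_\sigma=\{a:\pi_X(a)=\sigma\}$. \textbf{Lemma.} Let $\Gamma$ be a tree plan and let $S$ be a countably infinite set. Then: \begin{enumerate} \item $\Gamma(S)$ is ultrahomogeneous: every embedding of a finitely generated substructure of $\Gamma(S)$ into $\Gamma(S)$ extends to an automorphism of $\Gamma(S)$. \item $\Gamma(S)$ is the Fra\"iss\'e limit of the class of all $\mathcal L_\Gamma$-structures isomorphic to a substructure of $\Gamma(X)$ for some finite non-empty set $X$; that is, $\Gamma(S)$ is countable and ultrahomogeneous, and this class is exactly the class of finitely generated $\mathcal L_\Gamma$-structures that embed into $\Gamma(S)$. \item The complete theory $Th(\Gamma(S))$ is $\aleph_0$-categorical: any two of its models of cardinality $\aleph_0$ are isomorphic. \end{enumerate} -/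

import Mathlib

open scoped FirstOrder

universe u w

/-- The two possible values `1` and `∞` of the labelling of a tree plan. -/
inductive NodeLabel : Type
  | one : NodeLabel
  | infinity : NodeLabel

/-- A tree plan `(Γ, λ)`: a finite subtree `Γ` of `ω^{<ω}` (it contains the empty sequence and is
closed under deleting the last entry, hence under initial segments and meets), together with a
labelling `λ : Γ → {1, ∞}` which is `1` at the root. -/
structure TreePlan where
  nodes : Finset (List ℕ)
  nil_mem : [] ∈ nodes
  dropLast_mem : ∀ σ ∈ nodes, σ.dropLast ∈ nodes
  label : {σ : List ℕ // σ ∈ nodes} → NodeLabel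
  label_nil : label ⟨[], nil_mem⟩ = NodeLabel.one

/-- The meet of two finite sequences: their longest common initial segment. -/
noncomputable def seqMeet {α : Type u} : List α → List α → List α
  | [], _ => []
  | _ :: _, [] => []
  | a :: l, b :: m => open Classical in if a = b then a :: seqMeet l m else []

theorem seqMeet_le_left {α : Type u} (l m : List α) : seqMeet l m <+: l := by
  induction l generalizing m with
  | nil => simp [seqMeet]
  | cons a l ih =>
    cases m with
    | nil => simp [seqMeet]
    | cons b m =>
      by_cases h : a = b
      · simp [seqMeet, h, ih]
      · simp [seqMeet, h]

theorem seqMeet_le_right {α : Type u} (l m : List α) : seqMeet l m <+: m := by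
  induction l generalizing m with
  | nil => simp [seqMeet]
  | cons a l ih =>
    cases m with
    | nil => simp [seqMeet]
    | cons b m =>
      by_cases h : a = b
      · simp [seqMeet, h, ih]
      · simp [seqMeet, h]

theorem le_seqMeet {α : Type u} (k l m : List α) (hl : k <+: l) (hm : k <+: m) :
    k <+: seqMeet l m := by
  induction k generalizing l m with
  | nil => simp
  | cons c k ih =>
    cases l with
    | nil => simp at hl
    | cons a l =>
      cases m with
      | nil => simp at hm
      | cons b m =>
        rw [List.cons_prefix_cons] at hl hm
        obtain ⟨rfl, hl⟩ := hl
        obtain ⟨rfl, hm⟩ := hm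
        simpa [seqMeet] using ih l m hl hm

namespace TreePlan

theorem take_mem (Γ : TreePlan) (σ : List ℕ) (hσ : σ ∈ Γ.nodes) (k : ℕ) :
    σ.take k ∈ Γ.nodes := by
  induction σ using List.reverseRecOn with
  | nil => simpa using hσ
  | append_singleton l a ih =>
    have hl : l ∈ Γ.nodes := by simpa using Γ.dropLast_mem _ hσ
    rcases Nat.lt_or_ge l.length k with h | h
    · rwa [List.take_of_length_le (by simp; omega)]
    · rw [List.take_append_of_le_length h]
      exact ih hl

/-- A sequence `⟨(i₀,t₀),…,(iₙ,tₙ)⟩` over `ω × (X ∪ {⋆})` (with `⋆` being `none`) belongs to `Γ(X)`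
iff `⟨i₀,…,iₙ⟩ ∈ Γ` and, for every `k ≤ n`, `tₖ = ⋆` if `λ⟨i₀,…,iₖ⟩ = 1` and
`tₖ ∈ X` if `λ⟨i₀,…,iₖ⟩ = ∞`. -/
def IsPoint (Γ : TreePlan) (X : Type u) (a : List (ℕ × Option X)) : Prop :=
  ∃ h : a.map Prod.fst ∈ Γ.nodes, ∀ (k : ℕ) (hk : k < a.length),
    (Γ.label ⟨(a.map Prod.fst).take (k + 1), Γ.take_mem _ h (k + 1)⟩ = NodeLabel.one →
      a[k].2 = none) ∧
    (Γ.label ⟨(a.map Prod.fst).take (k + 1), Γ.take_mem _ h (k + 1)⟩ = NodeLabel.infinity →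
      ∃ x : X, a[k].2 = some x)

/-- The underlying set of `Γ(X)`. -/
def Points (Γ : TreePlan) (X : Type u) : Type u :=
  {a : List (ℕ × Option X) // Γ.IsPoint X a}

/-- The projection `π : Γ(X) → Γ`. -/
def proj (Γ : TreePlan) (X : Type u) (a : Γ.Points X) : {σ : List ℕ // σ ∈ Γ.nodes} :=
  ⟨a.1.map Prod.fst, a.2.1⟩

theorem isPoint_nil (Γ : TreePlan) (X : Type u) : Γ.IsPoint X [] :=
  ⟨Γ.nil_mem, fun _ hk => absurd hk (Nat.not_lt_zero _)⟩

theorem IsPoint.mono {Γ : TreePlan} {X : Type u} {a b : List (ℕ × Option X)}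
    (hb : Γ.IsPoint X b) (hab : a <+: b) : Γ.IsPoint X a := by
  obtain ⟨h, H⟩ := hb
  have key : a.map Prod.fst = (b.map Prod.fst).take a.length := by
    conv_lhs => rw [List.prefix_iff_eq_take.1 hab]
    rw [List.map_take]
  have hlen := hab.length_le
  refine ⟨key ▸ Γ.take_mem _ h _, fun k hk => ?_⟩
  have e : (a.map Prod.fst).take (k + 1) = (b.map Prod.fst).take (k + 1) := by
    rw [key, List.take_take, min_eq_left (by omega)]
  have e2 : a[k] = b[k]'(by omega) := hab.getElem hk
  have := H k (by omega)
  simpa only [e, e2] using this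

/-- Function symbols of `L_Γ`: the root, the predecessor and the meet. -/
inductive Func : ℕ → Type
  | root : Func 0
  | pred : Func 1
  | meet : Func 2

/-- Relation symbols of `L_Γ`: the tree order and a unary predicate `P_σ` for each `σ ∈ Γ`. -/
inductive Rel (Γ : TreePlan) : ℕ → Type
  | le : Rel Γ 2
  | P : {σ : List ℕ // σ ∈ Γ.nodes} → Rel Γ 1

/-- The language `L_Γ`. -/
def lang (Γ : TreePlan) : FirstOrder.Language.{0, 0} :=
  ⟨Func, Rel Γ⟩

/-- `Γ(X)` as an `L_Γ`-structure. -/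
noncomputable instance (Γ : TreePlan) (X : Type u) : Γ.lang.Structure (Γ.Points X) where
  funMap {_} f := match f with
    | Func.root => fun _ => ⟨[], Γ.isPoint_nil X⟩
    | Func.pred => fun v => ⟨(v 0).1.dropLast, (v 0).2.mono (List.dropLast_prefix _)⟩
    | Func.meet => fun v => ⟨seqMeet (v 0).1 (v 1).1, (v 0).2.mono (seqMeet_le_left _ _)⟩
  RelMap {_} r := match r with
    | Rel.le => fun v => (v 0).1 <+: (v 1).1
    | Rel.P σ => fun v => Γ.proj X (v 0) = σ

instance (Γ : TreePlan) : Countable (Σ n, Γ.lang.Functions n) := by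
  refine Function.Injective.countable (f := fun x : (Σ n, Γ.lang.Functions n) => x.1) ?_
  rintro ⟨_, f⟩ ⟨_, g⟩ h
  change Func _ at f
  change Func _ at g
  cases f <;> cases g <;> first | rfl | simp at h

instance (Γ : TreePlan) (X : Type u) [Countable X] : Countable (Γ.Points X) :=
  inferInstanceAs (Countable {a : List (ℕ × Option X) // Γ.IsPoint X a})

/-- The class of all `L_Γ`-structures isomorphic to a substructure of some `Γ(X)` with `X` a
finite non-empty set. -/
def finiteClass (Γ : TreePlan) : Set (CategoryTheory.Bundled.{u} Γ.lang.Structure) :=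
  {A | ∃ (X : Type u) (_ : Finite X) (_ : Nonempty X) (B : Γ.lang.Substructure (Γ.Points X)),
    Nonempty (A ≃[Γ.lang] B)}

end TreePlan

/-! The structures `Γ(S)` with `S` infinite are described by first-order axioms. `IsPlanTree`
collects universal ones: each point lies over one node of `Γ`, order and meet are governed by the
predecessor, and a point has at most one child over a node labelled `1`. `IsFullPlanTree` adds
extension axioms: the prescribed children exist, and over a node labelled `∞` they escape any finite
list.

In a plan tree every point reaches the root after finitely many predecessors, so finitely generated
substructures are finite, and an injection preserving predecessors and nodes is an embedding
(`embeddingMk`). To extend a finite partial isomorphism to `m`, first extend it to `pred m`, then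
send `m` to a fresh child of the image over the same node (`IsFullPlanTree.isExtensionPair`).
Back-and-forth then gives ultrahomogeneity and uniqueness of countable full plan trees. Since the
axioms pass to all models of the theory, categoricity follows. The age is computed by noting that
finitely many points involve only finitely many elements of `S`. -/

namespace TreePlan

open FirstOrder FirstOrder.Language FirstOrder.Language.Structure

/-! ### Axioms for plan trees and full plan trees -/

section Abstract

variable (Γ : TreePlan) {M : Type*} [Γ.lang.Structure M]

/-- The node of the plan obtained by deleting the last entry. -/
def parent (τ : {σ : List ℕ // σ ∈ Γ.nodes}) : {σ : List ℕ // σ ∈ Γ.nodes} :=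
  ⟨τ.1.dropLast, Γ.dropLast_mem _ τ.2⟩

/-- The root node of the plan. -/
def nilNode : {σ : List ℕ // σ ∈ Γ.nodes} := ⟨[], Γ.nil_mem⟩

/-- The constant symbol for the root. -/
def rootSymb : Γ.lang.Constants := Func.root

/-- The function symbol for the predecessor. -/
def predSymb : Γ.lang.Functions 1 := Func.pred

/-- The function symbol for the meet. -/
def meetSymb : Γ.lang.Functions 2 := Func.meet

/-- The relation symbol for the tree order. -/
def leSymb : Γ.lang.Relations 2 := Rel.le

/-- The relation symbol for the points over `σ`. -/
def pSymb (σ : {σ : List ℕ // σ ∈ Γ.nodes}) : Γ.lang.Relations 1 := Rel.P σ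

/-- The interpretation of the root constant. -/
def root (M : Type*) [Γ.lang.Structure M] : M := (Γ.rootSymb : M)

/-- The interpretation of the predecessor function. -/
def pred (x : M) : M := funMap Γ.predSymb ![x]

/-- The interpretation of the meet. -/
def meet (x y : M) : M := funMap Γ.meetSymb ![x, y]

/-- The interpretation of the tree order. -/
def LE (x y : M) : Prop := RelMap Γ.leSymb ![x, y]

/-- `Γ.Above σ x` says that `x` satisfies the predicate `P_σ`. -/
def Above (σ : {σ : List ℕ // σ ∈ Γ.nodes}) (x : M) : Prop := RelMap (Γ.pSymb σ) ![x]

theorem funMap_root (v : Fin 0 → M) : funMap Γ.rootSymb v = Γ.root M :=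
  congrArg (funMap Γ.rootSymb) (Subsingleton.elim _ _)

theorem funMap_pred (v : Fin 1 → M) : funMap Γ.predSymb v = Γ.pred (v 0) :=
  congrArg (funMap Γ.predSymb) (by ext i; fin_cases i; rfl)

theorem funMap_meet (v : Fin 2 → M) : funMap Γ.meetSymb v = Γ.meet (v 0) (v 1) :=
  congrArg (funMap Γ.meetSymb) (by ext i; fin_cases i <;> rfl)

theorem relMap_le (v : Fin 2 → M) : RelMap Γ.leSymb v ↔ Γ.LE (v 0) (v 1) :=
  iff_of_eq (congrArg (RelMap Γ.leSymb) (by ext i; fin_cases i <;> rfl))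

theorem relMap_P (σ : {σ : List ℕ // σ ∈ Γ.nodes}) (v : Fin 1 → M) :
    RelMap (Γ.pSymb σ) v ↔ Γ.Above σ (v 0) :=
  iff_of_eq (congrArg (RelMap (Γ.pSymb σ)) (by ext i; fin_cases i; rfl))

/-- The universal properties shared by all the structures `Γ(X)`. -/
structure IsPlanTree (M : Type*) [Γ.lang.Structure M] : Prop where
  exists_above : ∀ x : M, ∃ σ, Γ.Above σ x
  above_unique : ∀ σ τ, σ ≠ τ → ∀ x : M, Γ.Above σ x → ¬ Γ.Above τ x
  above_nil_iff : ∀ x : M, Γ.Above Γ.nilNode x ↔ x = Γ.root M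
  above_pred : ∀ σ, ∀ x : M, Γ.Above σ x → Γ.Above (Γ.parent σ) (Γ.pred x)
  le_iff : ∀ x y : M, Γ.LE x y ↔ x = y ∨ (¬ y = Γ.root M ∧ Γ.LE x (Γ.pred y))
  le_antisymm : ∀ x y : M, Γ.LE x y → Γ.LE y x → x = y
  meet_le_left : ∀ x y : M, Γ.LE (Γ.meet x y) x
  meet_le_right : ∀ x y : M, Γ.LE (Γ.meet x y) y
  le_meet : ∀ z x y : M, Γ.LE z x → Γ.LE z y → Γ.LE z (Γ.meet x y)
  child_unique : ∀ τ, τ.1 ≠ [] → Γ.label τ = NodeLabel.one → ∀ x y : M, Γ.Above τ x →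
    Γ.Above τ y → Γ.pred x = Γ.pred y → x = y

/-- A plan tree in which every point has the children prescribed by the plan, infinitely many of
them over a node labelled `∞`. -/
structure IsFullPlanTree (M : Type*) [Γ.lang.Structure M] : Prop extends Γ.IsPlanTree M where
  -- The last entry of `v` is the parent; the first `n` are points to avoid, none being allowed when
  -- the label is `1`.
  exists_child : ∀ τ, τ.1 ≠ [] → ∀ n : ℕ, (Γ.label τ = NodeLabel.one → n = 0) →
    ∀ v : Fin (n + 1) → M, Γ.Above (Γ.parent τ) (v (Fin.last n)) →
      ∃ y : M, Γ.pred y = v (Fin.last n) ∧ Γ.Above τ y ∧ ∀ i : Fin n, ¬ y = v i.castSucc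

/-- A set closed under the three operations, as a substructure. -/
def substructureMk (s : Set M) (h0 : Γ.root M ∈ s) (h1 : ∀ x ∈ s, Γ.pred x ∈ s)
    (h2 : ∀ x ∈ s, ∀ y ∈ s, Γ.meet x y ∈ s) : Γ.lang.Substructure M where
  carrier := s
  fun_mem {n} f v hv := by
    change Func n at f
    cases f with
    | root => exact (Γ.funMap_root v).symm ▸ h0
    | pred => exact (Γ.funMap_pred v).symm ▸ h1 _ (hv 0)
    | meet => exact (Γ.funMap_meet v).symm ▸ h2 _ (hv 0) _ (hv 1)

section Substructure

variable {Γ} (A : Γ.lang.Substructure M)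

theorem root_mem : Γ.root M ∈ A := A.fun_mem Γ.rootSymb _ (fun i => i.elim0)

theorem pred_mem {x : M} (hx : x ∈ A) : Γ.pred x ∈ A :=
  A.fun_mem Γ.predSymb _ (fun i => by fin_cases i; exact hx)

theorem coe_root : ((Γ.root A : A) : M) = Γ.root M := Γ.funMap_root _

theorem coe_pred (x : A) : ((Γ.pred x : A) : M) = Γ.pred (x : M) := Γ.funMap_pred _

theorem coe_meet (x y : A) : ((Γ.meet x y : A) : M) = Γ.meet (x : M) (y : M) := Γ.funMap_meet _

theorem coe_le (x y : A) : Γ.LE x y ↔ Γ.LE (x : M) (y : M) :=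
  Γ.relMap_le fun i => ((![x, y] i : A) : M)

theorem coe_above (σ) (x : A) : Γ.Above σ x ↔ Γ.Above σ (x : M) :=
  Γ.relMap_P σ fun i => ((![x] i : A) : M)

/-- Each axiom is universal in the points; its only existential ranges over nodes of `Γ`. -/
theorem IsPlanTree.substructure (hM : Γ.IsPlanTree M) : Γ.IsPlanTree A where
  exists_above x := by simpa only [coe_above] using hM.exists_above x
  above_unique σ τ h x := by simpa only [coe_above] using hM.above_unique σ τ h x
  above_nil_iff x := by
    simpa only [coe_above, Subtype.ext_iff, coe_root] using hM.above_nil_iff x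
  above_pred σ x := by simpa only [coe_above, coe_pred] using hM.above_pred σ x
  le_iff x y := by
    simpa only [coe_le, coe_pred, Subtype.ext_iff, coe_root] using hM.le_iff x y
  le_antisymm x y := by simpa only [coe_le, Subtype.ext_iff] using hM.le_antisymm x y
  meet_le_left x y := by simpa only [coe_le, coe_meet] using hM.meet_le_left x y
  meet_le_right x y := by simpa only [coe_le, coe_meet] using hM.meet_le_right x y
  le_meet z x y := by simpa only [coe_le, coe_meet] using hM.le_meet z x y
  child_unique τ h h' x y := by
    simpa only [coe_above, coe_pred, Subtype.ext_iff] using hM.child_unique τ h h' x y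

end Substructure

section Embedding

variable {Γ} {N : Type*} [Γ.lang.Structure N]

theorem embedding_pred (f : M ↪[Γ.lang] N) (x : M) : f (Γ.pred x) = Γ.pred (f x) := by
  rw [pred, f.map_fun, funMap_pred]; rfl

theorem embedding_above (f : M ↪[Γ.lang] N) (σ) (x : M) : Γ.Above σ (f x) ↔ Γ.Above σ x :=
  (Γ.relMap_P σ (f ∘ ![x])).symm.trans (f.map_rel _ _)

end Embedding

/-! ### Order, finiteness and embeddings from the predecessor -/

namespace IsPlanTree

variable {Γ} (hM : Γ.IsPlanTree M)
include hM

theorem pred_root : Γ.pred (Γ.root M) = Γ.root M := by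
  have h := hM.above_pred _ _ ((hM.above_nil_iff (Γ.root M)).2 rfl)
  exact (hM.above_nil_iff _).1 h

theorem above_eq {σ τ} {x : M} (h : Γ.Above σ x) (h' : Γ.Above τ x) : σ = τ :=
  by_contra fun hne => hM.above_unique σ τ hne x h h'

/-- Induction along the predecessor function. -/
theorem pred_induction {p : M → Prop} (h0 : p (Γ.root M))
    (hs : ∀ x, x ≠ Γ.root M → p (Γ.pred x) → p x) (x : M) : p x := by
  obtain ⟨σ, hσ⟩ := hM.exists_above x
  obtain ⟨n, hn⟩ : ∃ n, n = σ.1.length := ⟨_, rfl⟩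
  induction n generalizing x σ with
  | zero =>
    have : σ = Γ.nilNode := Subtype.ext (List.length_eq_zero_iff.1 hn.symm)
    rw [this, hM.above_nil_iff] at hσ
    exact hσ ▸ h0
  | succ n ih =>
    by_cases hx : x = Γ.root M
    · exact hx ▸ h0
    · exact hs x hx (ih _ _ (hM.above_pred _ _ hσ) (by simp [parent]; omega))

theorem le_refl (x : M) : Γ.LE x x := (hM.le_iff x x).2 (Or.inl rfl)

/-- Unfolding the recursive axiom `le_iff` terminates at the root. Thus the order is determined by
the predecessor alone. -/
theorem le_iff_iterate (x y : M) : Γ.LE x y ↔ ∃ k : ℕ, x = (Γ.pred (M := M))^[k] y := by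
  constructor
  · induction y using hM.pred_induction with
    | h0 =>
      intro h
      rw [hM.le_iff] at h
      exact ⟨0, by simpa using h⟩
    | hs y hy ih =>
      intro h
      rw [hM.le_iff] at h
      rcases h with h | ⟨-, h⟩
      · exact ⟨0, h⟩
      · obtain ⟨k, hk⟩ := ih h
        exact ⟨k + 1, hk⟩
  · rintro ⟨k, rfl⟩
    induction k generalizing y with
    | zero => exact hM.le_refl y
    | succ k ih =>
      by_cases hy : y = Γ.root M
      · have := ih y
        rwa [Function.iterate_succ_apply, hy, hM.pred_root, ← hy]
      · exact (hM.le_iff _ _).2 (Or.inr ⟨hy, ih _⟩)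

theorem pred_le (x : M) : Γ.LE (Γ.pred x) x := (hM.le_iff_iterate _ _).2 ⟨1, rfl⟩

theorem root_le (x : M) : Γ.LE (Γ.root M) x := by
  induction x using hM.pred_induction with
  | h0 => exact hM.le_refl _
  | hs x hx ih => exact (hM.le_iff _ _).2 (Or.inr ⟨hx, ih⟩)

theorem le_trans {x y z : M} (h : Γ.LE x y) (h' : Γ.LE y z) : Γ.LE x z := by
  rw [hM.le_iff_iterate] at *
  obtain ⟨k, rfl⟩ := h
  obtain ⟨l, rfl⟩ := h'
  exact ⟨k + l, (Function.iterate_add_apply _ _ _ _).symm⟩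

theorem meet_eq {x y z : M} (hx : Γ.LE z x) (hy : Γ.LE z y)
    (h : ∀ w, Γ.LE w x → Γ.LE w y → Γ.LE w z) : Γ.meet x y = z :=
  hM.le_antisymm _ _ (h _ (hM.meet_le_left x y) (hM.meet_le_right x y)) (hM.le_meet _ _ _ hx hy)

theorem meet_of_le {x y : M} (h : Γ.LE x y) : Γ.meet x y = x :=
  hM.meet_eq (hM.le_refl x) h fun _ h _ => h

theorem finite_setOf_le (x : M) : {z : M | Γ.LE z x}.Finite := by
  induction x using hM.pred_induction with
  | h0 =>
    refine (Set.finite_singleton (Γ.root M)).subset fun z hz => ?_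
    exact hM.le_antisymm _ _ hz (hM.root_le z)
  | hs x hx ih =>
    refine (ih.insert x).subset fun z hz => ?_
    rcases (hM.le_iff _ _).1 hz with h | h
    · exact Or.inl h
    · exact Or.inr h.2

/-- Finitely generated substructures of plan trees are finite. -/
theorem finite_of_fg {A : Γ.lang.Substructure M} (hA : A.FG) : (A : Set M).Finite := by
  obtain ⟨s, hs, rfl⟩ := Substructure.fg_def.1 hA
  -- A finite downward closed set containing the root is closed under all operations; the root is
  -- added in case `s` is empty.
  let t : Set M := insert (Γ.root M) (⋃ x ∈ s, {z | Γ.LE z x})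
  have ht : t.Finite := (hs.biUnion fun x _ => hM.finite_setOf_le x).insert _
  have hlow : ∀ x ∈ t, ∀ z, Γ.LE z x → z ∈ t := by
    intro x hx z hz
    rcases hx with rfl | hx
    · exact Or.inl (hM.le_antisymm _ _ hz (hM.root_le z))
    · simp only [Set.mem_iUnion] at hx
      obtain ⟨y, hy, hxy⟩ := hx
      exact Or.inr (Set.mem_biUnion hy (hM.le_trans hz hxy))
  let B := Γ.substructureMk t (Or.inl rfl) (fun x hx => hlow x hx _ (hM.pred_le x))
    (fun x hx y _ => hlow x hx _ (hM.meet_le_left x y))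
  refine ht.subset (Substructure.closure_le (S := B).2 fun x hx => ?_)
  exact Or.inr (Set.mem_biUnion hx (hM.le_refl x))

theorem mem_of_le {A : Γ.lang.Substructure M} {x y : M} (h : Γ.LE x y) (hy : y ∈ A) : x ∈ A := by
  obtain ⟨k, rfl⟩ := (hM.le_iff_iterate _ _).1 h
  clear h
  induction k generalizing y with
  | zero => exact hy
  | succ k ih => exact ih (pred_mem A hy)

/-- An injection between plan trees respecting predecessors and nodes is an embedding. -/
def embeddingMk {N : Type*} [Γ.lang.Structure N] (hN : Γ.IsPlanTree N) (f : M → N)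
    (hf : Function.Injective f) (hp : ∀ x, f (Γ.pred x) = Γ.pred (f x))
    (hc : ∀ σ x, Γ.Above σ x → Γ.Above σ (f x)) : M ↪[Γ.lang] N :=
  have hit (k : ℕ) (y : M) : f ((Γ.pred (M := M))^[k] y) = (Γ.pred (M := N))^[k] (f y) :=
    Function.Semiconj.iterate_right (f := f) hp k y
  have hle (x y : M) : Γ.LE (f x) (f y) ↔ Γ.LE x y := by
    simp only [hM.le_iff_iterate, hN.le_iff_iterate, ← hit, hf.eq_iff]
  { toFun := f
    inj' := hf
    map_fun' := fun {n} g v => by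
      change Func n at g
      cases g with
      | root =>
        change f (funMap Γ.rootSymb v) = funMap Γ.rootSymb (f ∘ v)
        rw [funMap_root, funMap_root, ← hN.above_nil_iff]
        exact hc _ _ ((hM.above_nil_iff _).2 rfl)
      | pred =>
        change f (funMap Γ.predSymb v) = funMap Γ.predSymb (f ∘ v)
        rw [funMap_pred, funMap_pred, hp]; rfl
      | meet =>
        change f (funMap Γ.meetSymb v) = funMap Γ.meetSymb (f ∘ v)
        rw [funMap_meet, funMap_meet]
        -- Any lower bound of the two images is an iterated predecessor of an image, hence itself an
        -- image, so it can be compared in `M`.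
        refine (hN.meet_eq ((hle _ _).2 (hM.meet_le_left _ _))
          ((hle _ _).2 (hM.meet_le_right _ _)) fun w hx hy => ?_).symm
        obtain ⟨k, rfl⟩ := (hN.le_iff_iterate _ _).1 hx
        simp only [← hit, hle] at hx hy ⊢
        exact hM.le_meet _ _ _ hx hy
    map_rel' := fun {n} r v => by
      change Rel Γ n at r
      cases r with
      | le =>
        change RelMap Γ.leSymb (f ∘ v) ↔ RelMap Γ.leSymb v
        rw [relMap_le, relMap_le]; exact hle _ _
      | P σ =>
        change RelMap (Γ.pSymb σ) (f ∘ v) ↔ RelMap (Γ.pSymb σ) v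
        rw [relMap_P, relMap_P]
        refine ⟨fun h => ?_, hc _ _⟩
        obtain ⟨τ, hτ⟩ := hM.exists_above (v 0)
        rwa [hN.above_eq h (hc _ _ hτ)] }

/-- A substructure together with a further point whose predecessor it contains. -/
def insertPoint (A : Γ.lang.Substructure M) (m : M) (hm : Γ.pred m ∈ A) : Γ.lang.Substructure M :=
  Γ.substructureMk (insert m (A : Set M)) (Or.inr (root_mem A))
    (fun x hx => by
      rcases hx with rfl | hx
      · exact Or.inr hm
      · exact Or.inr (pred_mem A hx))
    (fun x hx y hy => by
      rcases hx with rfl | hx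
      -- A point below the new one is either equal to it or below its predecessor, which lies in the
      -- downward closed `A`.
      · rcases (hM.le_iff _ _).1 (hM.meet_le_left x y) with h | h
        · exact Or.inl h
        · exact Or.inr (hM.mem_of_le h.2 hm)
      · exact Or.inr (hM.mem_of_le (hM.meet_le_left x y) hx))

end IsPlanTree

/-! ### Back-and-forth -/

/-- For label `∞` the finite image of `f` can be avoided outright. For label `1` freshness is
automatic: if the child were `f a`, then `a` and `m` would be children of one point over `τ`,
forcing `m = a ∈ A`. -/
theorem IsFullPlanTree.exists_child_notMem {Γ : TreePlan} {M N : Type*} [Γ.lang.Structure M]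
    [Γ.lang.Structure N] (hM : Γ.IsPlanTree M) (hN : Γ.IsFullPlanTree N)
    {A : Γ.lang.Substructure M} (hA : A.FG) (f : A ↪[Γ.lang] N) {m : M} (hmA : m ∉ A)
    (hm : Γ.pred m ∈ A) {τ} (hτ : Γ.Above τ m) :
    ∃ y : N, Γ.pred y = f ⟨Γ.pred m, hm⟩ ∧ Γ.Above τ y ∧ ∀ a, f a ≠ y := by
  have hτ0 : τ.1 ≠ [] := by
    intro h
    have : τ = Γ.nilNode := Subtype.ext h
    rw [this, hM.above_nil_iff] at hτ
    exact hmA (hτ ▸ root_mem A)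
  have hpar : Γ.Above (Γ.parent τ) (f ⟨Γ.pred m, hm⟩) := by
    rw [embedding_above, coe_above]
    exact hM.above_pred _ _ hτ
  by_cases hl : Γ.label τ = NodeLabel.one
  · obtain ⟨y, hy, hτy, -⟩ := hN.exists_child τ hτ0 0 (fun _ => rfl) (fun _ => f ⟨_, hm⟩) hpar
    refine ⟨y, hy, hτy, ?_⟩
    rintro a rfl
    rw [← embedding_pred] at hy
    rw [embedding_above, coe_above] at hτy
    have h := hM.child_unique τ hτ0 hl a m hτy hτ (by
      rw [← coe_pred, f.injective hy])
    exact hmA (h ▸ a.2)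
  · have : Finite A := (hM.finite_of_fg hA).to_subtype
    obtain ⟨n, ⟨e⟩⟩ := Finite.exists_equiv_fin A
    obtain ⟨y, hy, hτy, h⟩ := hN.exists_child τ hτ0 n (fun h => absurd h hl)
      (Fin.snoc (fun i => f (e.symm i)) (f ⟨_, hm⟩)) (by simpa using hpar)
    refine ⟨y, by simpa using hy, hτy, ?_⟩
    rintro a rfl
    exact h (e a) (by simp)

/-- Finite partial isomorphisms between full plan trees extend to any further point. -/
theorem IsFullPlanTree.isExtensionPair {Γ : TreePlan} {M N : Type*} [Γ.lang.Structure M]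
    [Γ.lang.Structure N] (hM : Γ.IsPlanTree M) (hN : Γ.IsFullPlanTree N) :
    Γ.lang.IsExtensionPair M N := by
  classical
  intro f m
  induction m using hM.pred_induction generalizing f with
  | h0 => exact ⟨f, root_mem _, _root_.le_refl f⟩
  | hs m hm0 ih =>
    obtain ⟨g, hg, hfg⟩ := ih f
    by_cases hmA : m ∈ g.1.dom
    · exact ⟨g, hmA, hfg⟩
    obtain ⟨τ, hτ⟩ := hM.exists_above m
    obtain ⟨y, hy, hτy, hya⟩ := hN.exists_child_notMem hM g.2 g.1.toEmbedding hmA hg hτ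
    let B := hM.insertPoint g.1.dom m hg
    have hAB : g.1.dom ≤ B := fun x hx => Or.inr hx
    let F : B → N := fun z => if h : (z : M) ∈ g.1.dom then g.1.toEmbedding ⟨z, h⟩ else y
    have hB : ∀ z : B, (z : M) ∉ g.1.dom → (z : M) = m := fun z h => z.2.resolve_right h
    have hF1 : ∀ (z : B) (h : (z : M) ∈ g.1.dom), F z = g.1.toEmbedding ⟨z, h⟩ :=
      fun z h => dif_pos h
    have hF2 : ∀ z : B, (z : M) ∉ g.1.dom → F z = y := fun z h => dif_neg h
    have hinj : Function.Injective F := by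
      intro x z h
      by_cases hx : (x : M) ∈ g.1.dom <;> by_cases hz : (z : M) ∈ g.1.dom
      · rw [hF1 x hx, hF1 z hz] at h
        exact Subtype.ext (congrArg (fun w : g.1.dom => (w : M)) (g.1.toEmbedding.injective h))
      · rw [hF1 x hx, hF2 z hz] at h
        exact absurd h (hya _)
      · rw [hF2 x hx, hF1 z hz] at h
        exact absurd h.symm (hya _)
      · exact Subtype.ext ((hB x hx).trans (hB z hz).symm)
    let E : B ↪[Γ.lang] N := (hM.substructure B).embeddingMk hN.toIsPlanTree F hinj
      (fun x => by
        by_cases hx : (x : M) ∈ g.1.dom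
        · have hpx : ((Γ.pred x : B) : M) ∈ g.1.dom := by
            rw [coe_pred]; exact pred_mem _ hx
          rw [hF1 _ hpx, hF1 _ hx, ← embedding_pred]
          congr 1
          exact Subtype.ext (by rw [coe_pred, coe_pred])
        · have hxm := hB x hx
          have hpx : ((Γ.pred x : B) : M) ∈ g.1.dom := by
            rw [coe_pred, hxm]; exact hg
          rw [hF1 _ hpx, hF2 _ hx, hy]
          congr 1
          exact Subtype.ext (by rw [coe_pred, hxm]))
      (fun σ x hx => by
        rw [coe_above] at hx
        by_cases hxA : (x : M) ∈ g.1.dom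
        · rwa [hF1 _ hxA, embedding_above, coe_above]
        · rw [hB x hxA] at hx
          rwa [hF2 _ hxA, hM.above_eq hx hτ])
    have hfin : Finite B := ((hM.finite_of_fg g.2).insert m).to_subtype
    refine ⟨⟨⟨B, E.toHom.range, E.equivRange⟩, Substructure.FG.of_finite⟩, Or.inl rfl,
      hfg.trans ⟨hAB, ?_⟩⟩
    ext x
    exact hF1 (Substructure.inclusion hAB x) x.2

/-- Countable full plan trees are unique up to isomorphism. -/
theorem IsFullPlanTree.nonempty_equiv {Γ : TreePlan} {M N : Type*} [Γ.lang.Structure M]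
    [Γ.lang.Structure N] [Countable M] [Countable N] (hM : Γ.IsFullPlanTree M)
    (hN : Γ.IsFullPlanTree N) : Nonempty (M ≃[Γ.lang] N) := by
  -- Back-and-forth starts from the partial isomorphism matching the two roots.
  let B : Γ.lang.Substructure M := Γ.substructureMk {Γ.root M} rfl
    (fun x hx => by rw [Set.mem_singleton_iff.1 hx]; exact hM.pred_root)
    (fun x hx y _ => by rw [Set.mem_singleton_iff.1 hx]; exact hM.meet_of_le (hM.root_le y))
  have hB : ∀ x : B, (x : M) = Γ.root M := fun x => x.2
  have hfin : Finite B := (Set.finite_singleton (Γ.root M)).to_subtype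
  let E : B ↪[Γ.lang] N := (hM.substructure B).embeddingMk hN.toIsPlanTree (fun _ => Γ.root N)
    (fun x y _ => Subtype.ext ((hB x).trans (hB y).symm)) (fun _ => hN.pred_root.symm)
    (fun σ x hx => by
      rw [coe_above, hB] at hx
      rw [hM.above_eq hx ((hM.above_nil_iff _).2 rfl), hN.above_nil_iff])
  obtain ⟨e, -⟩ := equiv_between_cg cg_of_countable cg_of_countable
    ⟨⟨B, E.toHom.range, E.equivRange⟩, Substructure.FG.of_finite⟩
    (isExtensionPair hM.toIsPlanTree hN) (isExtensionPair hN.toIsPlanTree hM)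
  exact ⟨e⟩

end Abstract
-- The concrete trees `Γ(X)`
theorem isPoint_concat (Γ : TreePlan) {X : Type*} (l : List (ℕ × Option X)) (i : ℕ)
    (t : Option X) : Γ.IsPoint X (l ++ [(i, t)]) ↔ Γ.IsPoint X l ∧
      ∃ h : l.map Prod.fst ++ [i] ∈ Γ.nodes,
        (Γ.label ⟨_, h⟩ = NodeLabel.one → t = none) ∧
        (Γ.label ⟨_, h⟩ = NodeLabel.infinity → ∃ x : X, t = some x) := by
  have e1 : (l ++ [(i, t)]).map Prod.fst = l.map Prod.fst ++ [i] := by simp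
  have e2 : ((l ++ [(i, t)]).map Prod.fst).take (l.length + 1) = l.map Prod.fst ++ [i] := by
    rw [e1, List.take_of_length_le (by simp)]
  have e3 : (l ++ [(i, t)])[l.length]'(by simp) = (i, t) := by simp
  constructor
  · intro H
    refine ⟨H.mono (List.prefix_append _ _), e1 ▸ H.1, ?_⟩
    obtain ⟨h, H⟩ := H
    simpa only [e2, e3] using H l.length (by simp)
  · rintro ⟨⟨h, H⟩, h', H'⟩
    refine ⟨e1 ▸ h', fun k hk => ?_⟩
    rcases Nat.lt_or_ge k l.length with hkl | hkl
    · have e4 : ((l ++ [(i, t)]).map Prod.fst).take (k + 1) = (l.map Prod.fst).take (k + 1) := by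
        rw [e1, List.take_append_of_le_length (by simpa using hkl)]
      simpa only [e4, List.getElem_append_left hkl] using H k hkl
    · obtain rfl : k = l.length := by simp at hk; omega
      simpa only [e2, e3] using H'

section Points

variable {Γ : TreePlan} {X : Type*}

namespace Points

/-- The sequence underlying a point. -/
def seq (a : Γ.Points X) : List (ℕ × Option X) := a.1

/-- The point with a given underlying sequence. -/
def mk (l : List (ℕ × Option X)) (h : Γ.IsPoint X l) : Γ.Points X := ⟨l, h⟩

theorem isPoint_seq (a : Γ.Points X) : Γ.IsPoint X a.seq := a.2

@[simp]
theorem seq_mk (l : List (ℕ × Option X)) (h : Γ.IsPoint X l) : (mk l h).seq = l := rfl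

theorem seq_injective : Function.Injective (seq : Γ.Points X → _) := Subtype.val_injective

theorem ext_iff {a b : Γ.Points X} : a = b ↔ a.seq = b.seq := seq_injective.eq_iff.symm

@[simp]
theorem seq_root : (Γ.root (Γ.Points X)).seq = [] := rfl

@[simp]
theorem seq_pred (a : Γ.Points X) : (Γ.pred a).seq = a.seq.dropLast := rfl

theorem le_iff (a b : Γ.Points X) : Γ.LE a b ↔ a.seq <+: b.seq := Iff.rfl

theorem above_iff (σ) (a : Γ.Points X) : Γ.Above σ a ↔ a.seq.map Prod.fst = σ.1 :=
  Subtype.ext_iff (a1 := Γ.proj X a) (a2 := σ)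

end Points

open Points

variable (Γ X)

theorem isPlanTree_points : Γ.IsPlanTree (Γ.Points X) where
  exists_above a := ⟨Γ.proj X a, rfl⟩
  above_unique σ τ h a ha ha' := h (by
    rw [above_iff] at ha ha'
    exact Subtype.ext (ha.symm.trans ha'))
  above_nil_iff a := by simp [above_iff, Points.ext_iff, nilNode]
  above_pred σ a h := by
    rw [above_iff] at h ⊢
    simp [parent, ← h, List.map_dropLast]
  le_iff a b := by
    rw [Points.le_iff, Points.le_iff, Points.ext_iff, Points.ext_iff, seq_root, seq_pred]
    rcases List.eq_nil_or_concat' b.seq with h | ⟨l, x, h⟩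
    · simp [h]
    · simp [h, List.prefix_concat_iff]
  le_antisymm a b h h' := seq_injective (List.IsPrefix.eq_of_length_le h h'.length_le)
  meet_le_left a b := seqMeet_le_left a.seq b.seq
  meet_le_right a b := seqMeet_le_right a.seq b.seq
  le_meet c a b h h' := le_seqMeet c.seq a.seq b.seq h h'
  child_unique τ hτ hl a b ha hb hab := by
    rw [above_iff] at ha hb
    rw [Points.ext_iff, seq_pred, seq_pred] at hab
    rw [Points.ext_iff]
    have hpa := a.isPoint_seq
    have hpb := b.isPoint_seq
    obtain ⟨τ, hτm⟩ := τ
    generalize a.seq = a, b.seq = b at *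
    dsimp only at *
    rcases List.eq_nil_or_concat' a with rfl | ⟨l, ⟨i, s⟩, rfl⟩
    · exact absurd ha.symm hτ
    rcases List.eq_nil_or_concat' b with rfl | ⟨l', ⟨i', s'⟩, rfl⟩
    · exact absurd hb.symm hτ
    obtain rfl : l = l' := by simpa using hab
    obtain rfl : i = i' := by simpa using ha.trans hb.symm
    rw [isPoint_concat] at hpa hpb
    simp only [List.map_append, List.map_cons, List.map_nil] at ha
    subst ha
    obtain ⟨-, h, h1, -⟩ := hpa
    obtain ⟨-, h', h1', -⟩ := hpb
    rw [h1 hl, h1' hl]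

theorem isFullPlanTree_points [Infinite X] : Γ.IsFullPlanTree (Γ.Points X) where
  toIsPlanTree := Γ.isPlanTree_points X
  exists_child τ hτ n hn v hv := by
    generalize v (Fin.last n) = x at hv ⊢
    rw [above_iff] at hv
    have hpx := x.isPoint_seq
    obtain ⟨τ, hτm⟩ := τ
    simp only [Points.ext_iff (b := x), above_iff, seq_pred]
    generalize x.seq = x at *
    dsimp only [parent] at *
    rcases List.eq_nil_or_concat' τ with rfl | ⟨σ, i, rfl⟩
    · exact absurd rfl hτ
    obtain rfl : x.map Prod.fst = σ := by simpa using hv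
    cases hl : Γ.label ⟨_, hτm⟩ with
    | one =>
      obtain rfl := hn hl
      exact ⟨.mk (x ++ [(i, none)]) ((Γ.isPoint_concat _ _ _).2
        ⟨hpx, hτm, fun _ => rfl, by simp [hl]⟩), by simp, by simp, fun i => i.elim0⟩
    | infinity =>
      -- One child for each element of the infinite set `X`, so some child is outside the range of
      -- `v`.
      let f : X → Γ.Points X := fun s => .mk (x ++ [(i, some s)]) ((Γ.isPoint_concat _ _ _).2
        ⟨hpx, hτm, by simp [hl], fun _ => ⟨s, rfl⟩⟩)
      have hf : Function.Injective f := fun s t h => by simpa [f] using congrArg seq h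
      obtain ⟨y, ⟨s, rfl⟩, hy⟩ := (Set.infinite_range_of_injective hf).exists_notMem_finite
        (Set.finite_range v)
      exact ⟨f s, by simp [f], by simp [f], fun i h => hy ⟨_, h.symm⟩⟩

/-! ### Functoriality in `X` and the age -/

variable {X} {Y : Type*} (j : X → Y)

theorem isPoint_map_iff (a : List (ℕ × Option X)) :
    Γ.IsPoint Y (a.map (Prod.map id (Option.map j))) ↔ Γ.IsPoint X a := by
  induction a using List.reverseRecOn with
  | nil => simp [isPoint_nil]
  | append_singleton l a ih =>
    obtain ⟨i, t⟩ := a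
    have e : (l.map (Prod.map id (Option.map j))).map Prod.fst = l.map Prod.fst := by simp
    simp only [List.map_append, List.map_cons, List.map_nil, Prod.map_apply, isPoint_concat, ih, e,
      id_eq]
    cases t <;> simp

/-- The embedding of `Γ(X)` into `Γ(Y)` induced by an injection. -/
noncomputable def pointsMap {j : X → Y} (hj : Function.Injective j) :
    Γ.Points X ↪[Γ.lang] Γ.Points Y :=
  (Γ.isPlanTree_points X).embeddingMk (Γ.isPlanTree_points Y)
    (fun a => .mk (a.seq.map (Prod.map id (Option.map j))) ((Γ.isPoint_map_iff j _).2 a.2))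
    (fun a b h => seq_injective (List.map_injective_iff.2
      (Function.injective_id.prodMap (Option.map_injective hj)) (congrArg seq h)))
    (fun a => by simp [Points.ext_iff, List.map_dropLast])
    (fun σ a h => by
      rw [above_iff] at h ⊢
      rw [seq_mk, List.map_map, ← h]
      rfl)

theorem exists_pointsMap_eq {F : Set Y} (a : Γ.Points Y)
    (h : ∀ p ∈ a.seq, ∀ y ∈ p.2, y ∈ F) :
    ∃ b : Γ.Points F, Γ.pointsMap (Subtype.val_injective (p := (· ∈ F))) b = a := by
  obtain ⟨l, hl⟩ :
      a.seq ∈ Set.range (List.map (Prod.map id (Option.map (Subtype.val : F → Y)))) := by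
    rw [Set.range_list_map]
    rintro ⟨i, t⟩ hp
    cases t with
    | none => exact ⟨(i, none), rfl⟩
    | some y => exact ⟨(i, some ⟨y, h _ hp y rfl⟩), rfl⟩
  exact ⟨.mk l ((Γ.isPoint_map_iff Subtype.val l).1 (hl ▸ a.isPoint_seq)), seq_injective hl⟩

instance [Finite X] : Finite (Γ.Points X) := by
  obtain ⟨N, hN⟩ := (Γ.nodes.finite_toSet.image List.length).bddAbove
  have : Finite {l : List (Option X) // l.length ≤ N} := (List.finite_length_le _ N).to_subtype
  have hlen (a : Γ.Points X) : (a.seq.map Prod.snd).length ≤ N := by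
    have h : (a.seq.map Prod.fst).length ≤ N := hN ⟨_, a.2.1, rfl⟩
    simpa using h
  refine Finite.of_injective (β := {σ // σ ∈ Γ.nodes} × {l : List (Option X) // l.length ≤ N})
    (fun a => (Γ.proj X a, ⟨a.seq.map Prod.snd, hlen a⟩)) fun a b h => seq_injective ?_
  have h1 : a.seq.map Prod.fst = b.seq.map Prod.fst := congrArg (fun p => p.1.1) h
  have h2 : a.seq.map Prod.snd = b.seq.map Prod.snd := congrArg (fun p => p.2.1) h
  rw [← List.zip_unzip a.seq, ← List.zip_unzip b.seq, List.unzip_eq_map, List.unzip_eq_map, h1, h2]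

variable {Γ}

theorem age_points (S : Type u) [Infinite S] : Γ.lang.age (Γ.Points S) = Γ.finiteClass := by
  ext A
  constructor
  · rintro ⟨hA, ⟨e⟩⟩
    have hfin : (Set.range e).Finite :=
      (Γ.isPlanTree_points S).finite_of_fg (hA.range e.toHom)
    obtain ⟨s₀⟩ : Nonempty S := inferInstance
    -- All elements of `S` occurring in the image of `e`; `s₀` only ensures that `F` is non-empty.
    let F : Set S := insert s₀ (⋃ a ∈ Set.range e, ⋃ p ∈ {p | p ∈ a.seq}, {y | y ∈ p.2})
    have hF : F.Finite := by
      refine (hfin.biUnion fun a _ => (List.finite_toSet a.seq).biUnion fun p _ => ?_).insert _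
      exact Set.Subsingleton.finite fun x hx y hy => Option.mem_unique hx hy
    let i := Γ.pointsMap (Subtype.val_injective (p := (· ∈ F)))
    have hle : e.toHom.range ≤ i.toHom.range := by
      rintro _ ⟨x, rfl⟩
      refine Γ.exists_pointsMap_eq (e x) fun p hp y hy => Or.inr ?_
      exact Set.mem_biUnion ⟨x, rfl⟩ (Set.mem_biUnion hp hy)
    let e' : A ↪[Γ.lang] Γ.Points F := i.equivRange.symm.toEmbedding.comp
      ((Substructure.inclusion hle).comp e.equivRange.toEmbedding)
    exact ⟨F, hF.to_subtype, ⟨⟨s₀, Or.inl rfl⟩⟩, e'.toHom.range, ⟨e'.equivRange⟩⟩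
  · rintro ⟨X, _, _, B, ⟨e⟩⟩
    have : Finite A := Finite.of_equiv B e.symm.toEquiv
    obtain ⟨j⟩ : Nonempty (X ↪ S) :=
      ⟨(Finite.equivFin X).toEmbedding.trans (Fin.valEmbedding.trans (Infinite.natEmbedding S))⟩
    exact ⟨Structure.FG.of_finite,
      ⟨(Γ.pointsMap j.injective).comp (B.subtype.comp e.toEmbedding)⟩⟩

end Points

/-! ### First-order expressibility of the axioms -/

section Transfer

open BoundedFormula

variable {Γ : TreePlan} {M N : Type*} [Γ.lang.Structure M] [Γ.lang.Structure N]

/-- The sentence saying that a point over the parent of `τ` has a child over `τ` outside any list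
of `n` points. -/
noncomputable def childSentence (Γ : TreePlan) (τ : {σ : List ℕ // σ ∈ Γ.nodes}) (n : ℕ) :
    Γ.lang.Sentence :=
  let x : Γ.lang.Term (Empty ⊕ Fin (n + 1)) := Term.var (Sum.inr (Fin.last n))
  let x' : Γ.lang.Term (Empty ⊕ Fin (n + 2)) := Term.var (Sum.inr (Fin.last n).castSucc)
  let y : Γ.lang.Term (Empty ⊕ Fin (n + 2)) := Term.var (Sum.inr (Fin.last (n + 1)))
  let z (i : Fin n) : Γ.lang.Term (Empty ⊕ Fin (n + 2)) :=
    Term.var (Sum.inr i.castSucc.castSucc)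
  ((Γ.pSymb (Γ.parent τ)).boundedFormula₁ x ⟹
    ∃' ((((Γ.predSymb.apply₁ y) =' x') ⊓ (Γ.pSymb τ).boundedFormula₁ y) ⊓
      BoundedFormula.iInf fun i : Fin n => ∼(y =' z i))).alls

theorem realize_childSentence (τ : {σ : List ℕ // σ ∈ Γ.nodes}) (n : ℕ) :
    M ⊨ Γ.childSentence τ n ↔ ∀ v : Fin (n + 1) → M, Γ.Above (Γ.parent τ) (v (Fin.last n)) →
      ∃ y : M, Γ.pred y = v (Fin.last n) ∧ Γ.Above τ y ∧ ∀ i : Fin n, ¬ y = v i.castSucc := by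
  refine realize_alls.trans ?_
  simp [Above, pred, and_assoc]

/-- Being a full plan tree is a property of the complete theory. -/
theorem IsFullPlanTree.of_model_completeTheory [N ⊨ Γ.lang.completeTheory M]
    (hM : Γ.IsFullPlanTree M) : Γ.IsFullPlanTree N := by
  have tr (φ : Γ.lang.Sentence) : M ⊨ φ → N ⊨ φ :=
    (realize_iff_of_model_completeTheory M N φ).2
  refine ⟨⟨?_, fun σ τ h => ?_, ?_, fun σ => ?_, ?_, ?_, ?_, ?_, ?_, fun τ hτ hl => ?_⟩,
    fun τ hτ n hn => ?_⟩
  -- Finiteness of `Γ` is what makes this a single sentence: the disjunction runs over its nodes.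
  · simpa [Sentence.Realize, Formula.Realize, Fin.snoc, Above] using
      tr (∀' BoundedFormula.iSup fun σ => (Γ.pSymb σ).boundedFormula₁ (&0))
      (by simpa [Sentence.Realize, Formula.Realize, Fin.snoc, Above] using hM.exists_above)
  · simpa [Sentence.Realize, Formula.Realize, Fin.snoc, Above] using
      tr (∀' ((Γ.pSymb σ).boundedFormula₁ (&0) ⟹ ∼((Γ.pSymb τ).boundedFormula₁ (&0))))
      (by simpa [Sentence.Realize, Formula.Realize, Fin.snoc, Above] using
        hM.above_unique σ τ h)
  · simpa [Sentence.Realize, Formula.Realize, Fin.snoc, Above, root] using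
      tr (∀' ((Γ.pSymb Γ.nilNode).boundedFormula₁ (&0) ⇔ ((&0) =' Γ.rootSymb.term)))
      (by simpa [Sentence.Realize, Formula.Realize, Fin.snoc, Above, root] using
        hM.above_nil_iff)
  · simpa [Sentence.Realize, Formula.Realize, Fin.snoc, Above, pred] using
      tr (∀' ((Γ.pSymb σ).boundedFormula₁ (&0) ⟹
        (Γ.pSymb (Γ.parent σ)).boundedFormula₁ (Γ.predSymb.apply₁ (&0))))
      (by simpa [Sentence.Realize, Formula.Realize, Fin.snoc, Above, pred] using
        hM.above_pred σ)
  · simpa [Sentence.Realize, Formula.Realize, Fin.snoc, LE, pred, root]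
      using tr (∀' ∀' (Γ.leSymb.boundedFormula₂ (&0) (&1) ⇔ (((&0) =' (&1)) ⊔
        (∼((&1) =' Γ.rootSymb.term) ⊓ Γ.leSymb.boundedFormula₂ (&0) (Γ.predSymb.apply₁ (&1))))))
      (by simpa [Sentence.Realize, Formula.Realize, Fin.snoc, LE, pred,
        root] using hM.le_iff)
  · simpa [Sentence.Realize, Formula.Realize, Fin.snoc, LE] using
      tr (∀' ∀' (Γ.leSymb.boundedFormula₂ (&0) (&1) ⟹ Γ.leSymb.boundedFormula₂ (&1) (&0) ⟹
        ((&0) =' (&1))))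
      (by simpa [Sentence.Realize, Formula.Realize, Fin.snoc, LE] using hM.le_antisymm)
  · simpa [Sentence.Realize, Formula.Realize, Fin.snoc, LE, meet] using
      tr (∀' ∀' (Γ.leSymb.boundedFormula₂ (Γ.meetSymb.apply₂ (&0) (&1)) (&0)))
      (by simpa [Sentence.Realize, Formula.Realize, Fin.snoc, LE, meet] using
        hM.meet_le_left)
  · simpa [Sentence.Realize, Formula.Realize, Fin.snoc, LE, meet] using
      tr (∀' ∀' (Γ.leSymb.boundedFormula₂ (Γ.meetSymb.apply₂ (&0) (&1)) (&1)))
      (by simpa [Sentence.Realize, Formula.Realize, Fin.snoc, LE, meet] using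
        hM.meet_le_right)
  · simpa [Sentence.Realize, Formula.Realize, Fin.snoc, LE, meet] using
      tr (∀' ∀' ∀' (Γ.leSymb.boundedFormula₂ (&0) (&1) ⟹ Γ.leSymb.boundedFormula₂ (&0) (&2) ⟹
        Γ.leSymb.boundedFormula₂ (&0) (Γ.meetSymb.apply₂ (&1) (&2))))
      (by simpa [Sentence.Realize, Formula.Realize, Fin.snoc, LE, meet] using
        hM.le_meet)
  · simpa [Sentence.Realize, Formula.Realize, Fin.snoc, Above, pred] using
      tr (∀' ∀' ((Γ.pSymb τ).boundedFormula₁ (&0) ⟹ (Γ.pSymb τ).boundedFormula₁ (&1) ⟹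
        ((Γ.predSymb.apply₁ (&0)) =' (Γ.predSymb.apply₁ (&1))) ⟹ ((&0) =' (&1))))
      (by simpa [Sentence.Realize, Formula.Realize, Fin.snoc, Above, pred] using
        hM.child_unique τ hτ hl)
  · exact (realize_childSentence τ n).1
      (tr _ ((realize_childSentence τ n).2 (hM.exists_child τ hτ n hn)))

end Transfer

end TreePlan

theorem mainTheorem6 (Γ : TreePlan) (S : Type u) [Countable S] [Infinite S] :
    Γ.lang.IsUltrahomogeneous (Γ.Points S) ∧
    FirstOrder.Language.IsFraisseLimit (L := Γ.lang) Γ.finiteClass.{u} (Γ.Points S) ∧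
    Cardinal.Categorical (Cardinal.aleph0.{w}) (Γ.lang.completeTheory (Γ.Points S)) := by
  have hfull := Γ.isFullPlanTree_points S
  have hhom : Γ.lang.IsUltrahomogeneous (Γ.Points S) :=
    (FirstOrder.Language.isUltrahomogeneous_iff_IsExtensionPair
      FirstOrder.Language.Structure.cg_of_countable).2
      (TreePlan.IsFullPlanTree.isExtensionPair hfull.toIsPlanTree hfull)
  refine ⟨hhom, ⟨hhom, TreePlan.age_points S⟩, fun M N hM hN => ?_⟩
  have : Countable M := Cardinal.mk_le_aleph0_iff.1 hM.le
  have : Countable N := Cardinal.mk_le_aleph0_iff.1 hN.le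
  exact (hfull.of_model_completeTheory (N := M)).nonempty_equiv
    (hfull.of_model_completeTheory (N := N))
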